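/- For a positive integer $n$, let $\mathcal T_n$ be the set of trees $T$ on the vertex set $[n]=\{1,\dots,n\}$ that are - alternating: the vertices along any path in $T$ form an alternating sequence $\cdots>i<j>k<\cdots$; and - non-crossing: there are no $i<j<k<l$ such that both $\{i,k\}$ and $\{j,l\}$ are edges of $T$. Let $T\in\mathcal T_n$. An unordered pair of distinct edges of $T$ is called a right pair if its edges can be written as $\{a,d\}$ and $\{b,c\}$ with $a\le b<c<d$ such that $\{b,c\}$ lies in the connected component of $a$ in $T\setminus\{\{a,d\}\}$ (the edge $\{a,d\}$ is deleted, all vertices are kept). It is called a left pair if its edges can be written as $\{a,d\}$ and $\{b,c\}$ with $a<b<c\le d$ such that $\{b,c\}$ lies in the connected component of $d$ in $T\setminus\{\{a,d\}\}$. Let $\mathrm{rp}(T)$ and $\mathrm{lp}(T)$ be the numbers of right and left pairs of $T$. Define $\widetilde C_m(q,t)$ for $m\ge 0$ by $\widetilde C_0(q,t)=1$ and $$\widetilde C_{m+1}(q,t)=\sum_{k=0}^{m}q^k t^{m-k}\,\widetilde C_k(q,t)\,\widetilde C_{m-k}(q,t)\qquad(m\ge 0).$$ Then for every positive integer $n$,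 $$\sum_{T\in\mathcal T_n}q^{\mathrm{rp}(T)}t^{\mathrm{lp}(T)}=\widetilde C_{n-1}(q,t),$$ as an identity of polynomials in $q,t$; that is, it holds for all elements $q,t$ of every commutative semiring. -/

import Mathlib

/-- The `(q,t)`-Catalan numbers `C̃ₙ(q,t)`, evaluated at elements `q`, `t` of a commutative
semiring: `C̃₀ = 1` and `C̃ₙ₊₁ = ∑_{k=0}^{n} q^k t^(n-k) C̃ₖ C̃ₙ₋ₖ`. -/
def qtCatalan {R : Type*} [CommSemiring R] (q t : R) : ℕ → R
  | 0 => 1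
  | n + 1 => ∑ k : Fin (n + 1),
      q ^ (k : ℕ) * t ^ (n - (k : ℕ)) * qtCatalan q t k * qtCatalan q t (n - (k : ℕ))

namespace SimpleGraph

/-- No two edges cross when the vertices are placed on a circle in their natural order and
edges are drawn as chords. -/
def IsNonCrossing {n : ℕ} (T : SimpleGraph (Fin n)) : Prop :=
  ∀ i j k l : Fin n, i < j → j < k → k < l → ¬ (T.Adj i k ∧ T.Adj j l)

/-- The vertices along any path form an alternating sequence `⋯ > i < j > k < ⋯`: every
interior vertex of a path is a local maximum or a local minimum of the path. -/
def IsPathAlternating {n : ℕ} (T : SimpleGraph (Fin n)) : Prop :=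
  ∀ (u v : Fin n) (p : T.Walk u v), p.IsPath → ∀ i : ℕ, i + 2 ≤ p.length →
    (p.getVert i < p.getVert (i + 1) ∧ p.getVert (i + 2) < p.getVert (i + 1)) ∨
    (p.getVert (i + 1) < p.getVert i ∧ p.getVert (i + 1) < p.getVert (i + 2))

open Classical in
/-- The set of alternating non-crossing trees on the `n` linearly ordered vertices of `Fin n`. -/
noncomputable def altNonCrossingTrees (n : ℕ) : Finset (SimpleGraph (Fin n)) :=
  {T | T.IsTree ∧ T.IsPathAlternating ∧ T.IsNonCrossing}

/-- The edge `{b, c}` lies in the component of the vertex `x` in `T` with the edge `{a, d}`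
deleted (all vertices being kept). -/
def InComponent {n : ℕ} (T : SimpleGraph (Fin n)) (a d x b c : Fin n) : Prop :=
  (T.deleteEdges {s(a, d)}).Adj b c ∧
    (T.deleteEdges {s(a, d)}).Reachable x b ∧ (T.deleteEdges {s(a, d)}).Reachable x c

/-- The set of right pairs of `T`, as unordered pairs `{e, f}` of distinct edges. -/
def rightPairs {n : ℕ} (T : SimpleGraph (Fin n)) : Set (Sym2 (Sym2 (Fin n))) :=
  {P | ∃ e ∈ T.edgeSet, ∃ f ∈ T.edgeSet, e ≠ f ∧ P = s(e, f) ∧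
    ∃ a b c d : Fin n, e = s(a, d) ∧ f = s(b, c) ∧ a ≤ b ∧ b < c ∧ c < d ∧
      T.InComponent a d a b c}

/-- The set of left pairs of `T`, as unordered pairs `{e, f}` of distinct edges. -/
def leftPairs {n : ℕ} (T : SimpleGraph (Fin n)) : Set (Sym2 (Sym2 (Fin n))) :=
  {P | ∃ e ∈ T.edgeSet, ∃ f ∈ T.edgeSet, e ≠ f ∧ P = s(e, f) ∧
    ∃ a b c d : Fin n, e = s(b, c) ∧ f = s(a, d) ∧ a < b ∧ b < c ∧ c ≤ d ∧
      T.InComponent a d d b c}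

/-- The number of right pairs. -/
noncomputable def rp {n : ℕ} (T : SimpleGraph (Fin n)) : ℕ := T.rightPairs.ncard

/-- The number of left pairs. -/
noncomputable def lp {n : ℕ} (T : SimpleGraph (Fin n)) : ℕ := T.leftPairs.ncard

end SimpleGraph

namespace SimpleGraph

/-! The trees satisfy the recursion that defines `qtCatalan`. A tree in `altNonCrossingTrees (m +
2)` contains the edge joining the first and last vertices (`adj_zero_last`). Deleting it leaves two
components, which are intervals because edges do not cross (`exists_isGlue`). Conversely, gluing two
such trees along this outer edge gives such a tree, and the cut point is recovered from the
component of the first vertex (`IsGlue.index_le`).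

For the weights, sort pairs by their longer edge `{a, d}`. If it lies in a block, the pair is a pair
of that block. If it is the outer edge, `{b, c}` is any edge of the left block for right pairs, of
the right block for left pairs. Blocks with `k + 1` and `m - k + 1` vertices have `k` and `m - k`
edges, whence the factor `q ^ k * t ^ (m - k)`. -/

theorem isPathAlternating_iff {n : ℕ} {T : SimpleGraph (Fin n)} :
    T.IsPathAlternating ↔ ∀ x y z : Fin n, T.Adj x y → T.Adj y z → x < y → ¬ y < z := by
  constructor
  · intro h x y z hxy hyz h1 h2
    have hp : (Walk.cons hxy (Walk.cons hyz Walk.nil)).IsPath := by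
      simp [hxy.ne, hyz.ne, (h1.trans h2).ne]
    have := h _ _ _ hp 0 (by simp)
    simp only [Nat.zero_add, Walk.getVert_zero, Walk.getVert_cons_succ] at this
    rcases this with h | h
    · exact absurd h.2 h2.not_gt
    · exact absurd h.1 h1.not_gt
  · intro h u v p _ i hi
    have h1 := p.adj_getVert_succ (i := i) (by omega)
    have h2 := p.adj_getVert_succ (i := i + 1) (by omega)
    rcases lt_or_gt_of_ne h1.ne with h3 | h3
    · exact Or.inl ⟨h3, (lt_or_gt_of_ne h2.ne).resolve_left (h _ _ _ h1 h2 h3)⟩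
    · exact Or.inr ⟨h3, (lt_or_gt_of_ne h2.ne).resolve_right
        fun h4 => h _ _ _ h2.symm h1.symm h4 h3⟩

/-- Asking only for reachability of the images lets `f` collapse an edge to a point, as the
retractions below do. -/
theorem Reachable.map_of_adj {V W : Type*} {G : SimpleGraph V} {H : SimpleGraph W} (f : V → W)
    (hf : ∀ u v, G.Adj u v → H.Reachable (f u) (f v)) {u v : V} (h : G.Reachable u v) :
    H.Reachable (f u) (f v) := by
  obtain ⟨p⟩ := h
  induction p with
  | nil => exact Reachable.refl _
  | cons a _ ih => exact (hf _ _ a).trans ih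

theorem Reachable.exists_adj_of_mem_of_notMem {V : Type*} {G : SimpleGraph V} {u v : V}
    (h : G.Reachable u v) (S : Set V) (hu : u ∈ S) (hv : v ∉ S) :
    ∃ x y, G.Adj x y ∧ x ∈ S ∧ y ∉ S ∧ G.Reachable u x ∧ G.Reachable u y := by
  obtain ⟨p⟩ := h
  obtain ⟨d, hd, h1, h2⟩ := p.exists_boundary_dart S hu hv
  classical
  exact ⟨d.fst, d.snd, d.adj, h1, h2, ⟨p.takeUntil _ (p.dart_fst_mem_support_of_mem_darts hd)⟩,
    ⟨p.takeUntil _ (p.dart_snd_mem_support_of_mem_darts hd)⟩⟩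

/-! ### Retracts: passing from a graph to a block -/

/-- `T` is the induced subgraph of `G` on the range of `φ`, and `ρ` retracts `G` onto it by
collapsing every other edge. -/
structure IsRetract {s n : ℕ} (φ : Fin s ↪o Fin n) (ρ : Fin n → Fin s)
    (T : SimpleGraph (Fin s)) (G : SimpleGraph (Fin n)) : Prop where
  retract : ∀ x, ρ (φ x) = x
  adj_iff : ∀ x y, G.Adj (φ x) (φ y) ↔ T.Adj x y
  collapse : ∀ u v, G.Adj u v → ((∃ x, φ x = u) ∧ ∃ y, φ y = v) ∨ ρ u = ρ v

namespace IsRetract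

variable {s n : ℕ} {φ : Fin s ↪o Fin n} {ρ : Fin n → Fin s} {T : SimpleGraph (Fin s)}
  {G : SimpleGraph (Fin n)}

theorem deleteEdge (h : IsRetract φ ρ T G) (a d : Fin s) :
    IsRetract φ ρ (T.deleteEdges {s(a, d)}) (G.deleteEdges {s(φ a, φ d)}) where
  retract := h.retract
  adj_iff x y := by simp [deleteEdges_adj, h.adj_iff]
  collapse u v huv := h.collapse u v huv.1

/-- Walks in `G` are pushed down by `ρ`, walks in `T` are pushed up by `φ`. With `deleteEdge`, this
transfers components and bridges. -/
theorem reachable_iff (h : IsRetract φ ρ T G) (x y : Fin s) :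
    G.Reachable (φ x) (φ y) ↔ T.Reachable x y := by
  constructor
  · intro hr
    have := hr.map_of_adj (H := T) ρ ?_
    · simpa [h.retract] using this
    · intro u v huv
      rcases h.collapse u v huv with ⟨⟨x, rfl⟩, ⟨y, rfl⟩⟩ | he
      · rw [h.retract, h.retract]
        exact ((h.adj_iff _ _).1 huv).reachable
      · rw [he]
  · exact fun hr => hr.map_of_adj φ fun u v huv => ((h.adj_iff _ _).2 huv).reachable

theorem inComponent_iff (h : IsRetract φ ρ T G) (a d x b c : Fin s) :
    G.InComponent (φ a) (φ d) (φ x) (φ b) (φ c) ↔ T.InComponent a d x b c := by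
  have h' := h.deleteEdge a d
  simp only [InComponent, h'.adj_iff, h'.reachable_iff]

theorem isBridge_iff (h : IsRetract φ ρ T G) (a d : Fin s) :
    G.IsBridge s(φ a, φ d) ↔ T.IsBridge s(a, d) := by
  rw [SimpleGraph.isBridge_iff, SimpleGraph.isBridge_iff, (h.deleteEdge a d).reachable_iff]

theorem isTree (h : IsRetract φ ρ T G) (hs : 0 < s) (hG : G.IsTree) : T.IsTree := by
  have : Nonempty (Fin s) := ⟨⟨0, hs⟩⟩
  refine ⟨⟨fun x y => (h.reachable_iff x y).1 (hG.connected _ _)⟩, ?_⟩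
  -- Acyclicity is read as "every edge is a bridge", a statement about reachability alone.
  rw [isAcyclic_iff_forall_adj_isBridge]
  intro v w hvw
  rw [← h.isBridge_iff]
  exact isAcyclic_iff_forall_adj_isBridge.1 hG.isAcyclic ((h.adj_iff _ _).2 hvw)

theorem isPathAlternating (h : IsRetract φ ρ T G) (hG : G.IsPathAlternating) :
    T.IsPathAlternating := by
  rw [isPathAlternating_iff] at *
  intro x y z hxy hyz h1 h2
  exact hG (φ x) (φ y) (φ z) ((h.adj_iff _ _).2 hxy) ((h.adj_iff _ _).2 hyz)
    (φ.lt_iff_lt.2 h1) (φ.lt_iff_lt.2 h2)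

theorem isNonCrossing (h : IsRetract φ ρ T G) (hG : G.IsNonCrossing) : T.IsNonCrossing := by
  intro i j k l h1 h2 h3 h4
  exact hG (φ i) (φ j) (φ k) (φ l) (φ.lt_iff_lt.2 h1) (φ.lt_iff_lt.2 h2) (φ.lt_iff_lt.2 h3)
    ⟨(h.adj_iff _ _).2 h4.1, (h.adj_iff _ _).2 h4.2⟩

end IsRetract

theorem mem_altNonCrossingTrees {n : ℕ} {T : SimpleGraph (Fin n)} :
    T ∈ altNonCrossingTrees n ↔ T.IsTree ∧ T.IsPathAlternating ∧ T.IsNonCrossing := by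
  simp [altNonCrossingTrees]

theorem IsRetract.mem_altNonCrossingTrees {s n : ℕ} {φ : Fin s ↪o Fin n} {ρ : Fin n → Fin s}
    {T : SimpleGraph (Fin s)} {G : SimpleGraph (Fin n)} (h : IsRetract φ ρ T G) (hs : 0 < s)
    (hG : G ∈ altNonCrossingTrees n) : T ∈ altNonCrossingTrees s := by
  rw [SimpleGraph.mem_altNonCrossingTrees] at *
  exact ⟨h.isTree hs hG.1, h.isPathAlternating hG.2.1, h.isNonCrossing hG.2.2⟩

/-! ### Gluing two trees along an outer edge -/

section Glue

variable {a b n : ℕ}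

/-- The embedding of `Fin (a + 1)` as an initial segment. -/
def leftEmb (h : a + b + 2 = n) : Fin (a + 1) ↪o Fin n :=
  OrderEmbedding.ofMapLEIff (fun x => ⟨(x : ℕ), by omega⟩) fun _ _ => Iff.rfl

/-- The embedding of `Fin (b + 1)` as a final segment. -/
def rightEmb (h : a + b + 2 = n) : Fin (b + 1) ↪o Fin n :=
  OrderEmbedding.ofMapLEIff (fun x => ⟨a + 1 + (x : ℕ), by omega⟩) fun _ _ =>
    Nat.add_le_add_iff_left

theorem val_leftEmb (h : a + b + 2 = n) (x : Fin (a + 1)) : (leftEmb h x : ℕ) = x := rfl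

theorem val_rightEmb (h : a + b + 2 = n) (x : Fin (b + 1)) :
    (rightEmb h x : ℕ) = a + 1 + x := rfl

theorem exists_leftEmb (h : a + b + 2 = n) {u : Fin n} (hu : (u : ℕ) ≤ a) :
    ∃ x, leftEmb h x = u := ⟨⟨u, by omega⟩, rfl⟩

theorem exists_rightEmb (h : a + b + 2 = n) {u : Fin n} (hu : a < (u : ℕ)) :
    ∃ x, rightEmb h x = u := ⟨⟨u - (a + 1), by omega⟩, Fin.ext (by rw [val_rightEmb]; simp; omega)⟩

/-- The retraction onto the initial segment sending the rest to `0`. -/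
def leftRetr (a : ℕ) (u : Fin n) : Fin (a + 1) := if h : (u : ℕ) ≤ a then ⟨u, by omega⟩ else 0

/-- The retraction onto the final segment sending the rest to the last vertex. -/
def rightRetr (h : a + b + 2 = n) (u : Fin n) : Fin (b + 1) :=
  if (u : ℕ) ≤ a then Fin.last b else ⟨u - (a + 1), by omega⟩

theorem leftRetr_leftEmb (h : a + b + 2 = n) (x : Fin (a + 1)) :
    leftRetr a (leftEmb h x) = x := by
  have := x.2
  simp [leftRetr, val_leftEmb, Nat.lt_succ_iff.1 this]

theorem leftRetr_rightEmb (h : a + b + 2 = n) (x : Fin (b + 1)) :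
    leftRetr a (rightEmb h x) = 0 := by
  have : ¬ (a + 1 + (x : ℕ) ≤ a) := by omega
  simp [leftRetr, val_rightEmb, this]

theorem rightRetr_rightEmb (h : a + b + 2 = n) (x : Fin (b + 1)) :
    rightRetr h (rightEmb h x) = x := by
  have : ¬ (a + 1 + (x : ℕ) ≤ a) := by omega
  simp [rightRetr, val_rightEmb, this]

theorem rightRetr_leftEmb (h : a + b + 2 = n) (x : Fin (a + 1)) :
    rightRetr h (leftEmb h x) = Fin.last b := by
  have := x.2
  simp [rightRetr, val_leftEmb, Nat.lt_succ_iff.1 this]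

/-- `G` is obtained from `T₁` on the first `a + 1` vertices and `T₂` on the last `b + 1`
vertices by joining the first vertex to the last. -/
structure IsGlue (h : a + b + 2 = n) (T₁ : SimpleGraph (Fin (a + 1)))
    (T₂ : SimpleGraph (Fin (b + 1))) (G : SimpleGraph (Fin n)) : Prop where
  left_left : ∀ x y, G.Adj (leftEmb h x) (leftEmb h y) ↔ T₁.Adj x y
  right_right : ∀ x y, G.Adj (rightEmb h x) (rightEmb h y) ↔ T₂.Adj x y
  left_right : ∀ x y, G.Adj (leftEmb h x) (rightEmb h y) ↔ x = 0 ∧ y = Fin.last b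

theorem cases_emb (h : a + b + 2 = n) (u : Fin n) :
    (∃ x, leftEmb h x = u) ∨ ∃ x, rightEmb h x = u := by
  rcases Nat.lt_or_ge a u with hu | hu
  · exact Or.inr (exists_rightEmb h hu)
  · exact Or.inl (exists_leftEmb h hu)

theorem leftEmb_lt_rightEmb (h : a + b + 2 = n) (x : Fin (a + 1)) (y : Fin (b + 1)) :
    leftEmb h x < rightEmb h y := by
  rw [Fin.lt_def, val_leftEmb, val_rightEmb]; omega

/-- The graph obtained by joining the first vertex of `T₁` to the last vertex of `T₂`. -/
def glue (h : a + b + 2 = n) (T₁ : SimpleGraph (Fin (a + 1)))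
    (T₂ : SimpleGraph (Fin (b + 1))) : SimpleGraph (Fin n) :=
  T₁.map (leftEmb h).toEmbedding ⊔ T₂.map (rightEmb h).toEmbedding ⊔
    edge (leftEmb h 0) (rightEmb h (Fin.last b))

theorem isGlue_glue (h : a + b + 2 = n) (T₁ : SimpleGraph (Fin (a + 1)))
    (T₂ : SimpleGraph (Fin (b + 1))) : IsGlue h T₁ T₂ (glue h T₁ T₂) := by
  have hlr := fun x y => (leftEmb_lt_rightEmb h x y).ne
  have hrl := fun x y => (leftEmb_lt_rightEmb h x y).ne'
  have h₁ := map_adj (leftEmb h).toEmbedding T₁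
  have h₂ := map_adj (rightEmb h).toEmbedding T₂
  simp only [RelEmbedding.coe_toEmbedding] at h₁ h₂
  constructor <;> intro x y <;>
    simp [glue, edge_adj, h₁, h₂, hlr, hrl]

namespace IsGlue

variable {h : a + b + 2 = n} {T₁ : SimpleGraph (Fin (a + 1))} {T₂ : SimpleGraph (Fin (b + 1))}
  {G : SimpleGraph (Fin n)}

theorem right_left (hG : IsGlue h T₁ T₂ G) (x : Fin (b + 1)) (y : Fin (a + 1)) :
    G.Adj (rightEmb h x) (leftEmb h y) ↔ y = 0 ∧ x = Fin.last b := by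
  rw [G.adj_comm, hG.left_right]

/-- The only edge between the blocks meets the left one at `0`, exactly where `leftRetr` sends the
right block, so it is collapsed. -/
theorem isRetract_left (hG : IsGlue h T₁ T₂ G) : IsRetract (leftEmb h) (leftRetr a) T₁ G where
  retract := leftRetr_leftEmb h
  adj_iff := hG.left_left
  collapse u v huv := by
    rcases cases_emb h u with ⟨x, rfl⟩ | ⟨x, rfl⟩ <;> rcases cases_emb h v with ⟨y, rfl⟩ | ⟨y, rfl⟩
    · exact Or.inl ⟨⟨_, rfl⟩, _, rfl⟩
    · right; rw [leftRetr_leftEmb, leftRetr_rightEmb, ((hG.left_right _ _).1 huv).1]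
    · right; rw [leftRetr_leftEmb, leftRetr_rightEmb, ((hG.right_left _ _).1 huv).1]
    · right; rw [leftRetr_rightEmb, leftRetr_rightEmb]

theorem isRetract_right (hG : IsGlue h T₁ T₂ G) : IsRetract (rightEmb h) (rightRetr h) T₂ G where
  retract := rightRetr_rightEmb h
  adj_iff := hG.right_right
  collapse u v huv := by
    rcases cases_emb h u with ⟨x, rfl⟩ | ⟨x, rfl⟩ <;> rcases cases_emb h v with ⟨y, rfl⟩ | ⟨y, rfl⟩
    · right; rw [rightRetr_leftEmb, rightRetr_leftEmb]
    · right; rw [rightRetr_leftEmb, rightRetr_rightEmb, ((hG.left_right _ _).1 huv).2]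
    · right; rw [rightRetr_leftEmb, rightRetr_rightEmb, ((hG.right_left _ _).1 huv).2]
    · exact Or.inl ⟨⟨_, rfl⟩, _, rfl⟩

theorem eq_glue (hG : IsGlue h T₁ T₂ G) : G = glue h T₁ T₂ := by
  have hg := isGlue_glue h T₁ T₂
  ext u v
  rcases cases_emb h u with ⟨x, rfl⟩ | ⟨x, rfl⟩ <;> rcases cases_emb h v with ⟨y, rfl⟩ | ⟨y, rfl⟩
  · rw [hG.left_left, hg.left_left]
  · rw [hG.left_right, hg.left_right]
  · rw [hG.right_left, hg.right_left]
  · rw [hG.right_right, hg.right_right]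

theorem adj_top (hG : IsGlue h T₁ T₂ G) : G.Adj (leftEmb h 0) (rightEmb h (Fin.last b)) :=
  (hG.left_right _ _).2 ⟨rfl, rfl⟩

/-- The deleted edge was the only way out of the left block. -/
theorem le_of_reachable_deleteEdges (hG : IsGlue h T₁ T₂ G) {u v : Fin n}
    (hr : (G.deleteEdges {s(leftEmb h 0, rightEmb h (Fin.last b))}).Reachable u v)
    (hu : (u : ℕ) ≤ a) : (v : ℕ) ≤ a := by
  by_contra hv
  obtain ⟨x, y, hxy, hx, hy, -⟩ := hr.exists_adj_of_mem_of_notMem {w | (w : ℕ) ≤ a} hu hv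
  obtain ⟨x, rfl⟩ := exists_leftEmb h hx
  obtain ⟨y, rfl⟩ := exists_rightEmb h (not_le.1 hy)
  rw [deleteEdges_adj, hG.left_right] at hxy
  obtain ⟨⟨rfl, rfl⟩, hxy⟩ := hxy
  exact hxy rfl

theorem reachable_deleteEdges_left (hG : IsGlue h T₁ T₂ G) (hT : T₁.Connected)
    (x y : Fin (a + 1)) : (G.deleteEdges {s(leftEmb h 0, rightEmb h (Fin.last b))}).Reachable
      (leftEmb h x) (leftEmb h y) := by
  refine (hT x y).map_of_adj (leftEmb h) fun u v huv => Adj.reachable ?_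
  rw [deleteEdges_adj, hG.left_left]
  simp [huv, (leftEmb_lt_rightEmb h _ _).ne]

theorem reachable_deleteEdges_right (hG : IsGlue h T₁ T₂ G) (hT : T₂.Connected)
    (x y : Fin (b + 1)) : (G.deleteEdges {s(leftEmb h 0, rightEmb h (Fin.last b))}).Reachable
      (rightEmb h x) (rightEmb h y) := by
  refine (hT x y).map_of_adj (rightEmb h) fun u v huv => Adj.reachable ?_
  rw [deleteEdges_adj, hG.right_right]
  simp [huv, (leftEmb_lt_rightEmb h _ _).ne']

theorem reachable_deleteEdges_zero_iff (hG : IsGlue h T₁ T₂ G) (hT : T₁.Connected) (u : Fin n) :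
    (G.deleteEdges {s(leftEmb h 0, rightEmb h (Fin.last b))}).Reachable (leftEmb h 0) u ↔
      (u : ℕ) ≤ a := by
  refine ⟨fun hr => hG.le_of_reachable_deleteEdges hr (by simp [val_leftEmb]), fun hu => ?_⟩
  obtain ⟨x, rfl⟩ := exists_leftEmb h hu
  exact hG.reachable_deleteEdges_left hT _ _

theorem reachable_deleteEdges_last_iff (hG : IsGlue h T₁ T₂ G) (hT : T₂.Connected) (u : Fin n) :
    (G.deleteEdges {s(leftEmb h 0, rightEmb h (Fin.last b))}).Reachable
      (rightEmb h (Fin.last b)) u ↔ a < (u : ℕ) := by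
  constructor
  · intro hr
    by_contra hu
    have := hG.le_of_reachable_deleteEdges hr.symm (not_lt.1 hu)
    rw [val_rightEmb] at this
    omega
  · intro hu
    obtain ⟨x, rfl⟩ := exists_rightEmb h hu
    exact hG.reachable_deleteEdges_right hT _ _

theorem isTree (hG : IsGlue h T₁ T₂ G) (h₁ : T₁.IsTree) (h₂ : T₂.IsTree) : G.IsTree := by
  have : Nonempty (Fin n) := ⟨leftEmb h 0⟩
  constructor
  · refine (connected_iff_exists_forall_reachable G).2 ⟨leftEmb h 0, fun u => ?_⟩
    rcases cases_emb h u with ⟨x, rfl⟩ | ⟨x, rfl⟩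
    · exact (hG.isRetract_left.reachable_iff _ _).2 (h₁.connected _ _)
    · exact hG.adj_top.reachable.trans
        ((hG.isRetract_right.reachable_iff _ _).2 (h₂.connected _ _))
  · have htop : G.IsBridge s(leftEmb h 0, rightEmb h (Fin.last b)) := by
      rw [isBridge_iff, hG.reachable_deleteEdges_zero_iff h₁.connected, val_rightEmb]
      omega
    rw [isAcyclic_iff_forall_adj_isBridge]
    intro u v huv
    rcases cases_emb h u with ⟨x, rfl⟩ | ⟨x, rfl⟩ <;> rcases cases_emb h v with ⟨y, rfl⟩ | ⟨y, rfl⟩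
    · rw [hG.isRetract_left.isBridge_iff]
      exact isAcyclic_iff_forall_adj_isBridge.1 h₁.isAcyclic ((hG.left_left _ _).1 huv)
    · obtain ⟨rfl, rfl⟩ := (hG.left_right _ _).1 huv
      exact htop
    · obtain ⟨rfl, rfl⟩ := (hG.right_left _ _).1 huv
      rw [Sym2.eq_swap]
      exact htop
    · rw [hG.isRetract_right.isBridge_iff]
      exact isAcyclic_iff_forall_adj_isBridge.1 h₂.isAcyclic ((hG.right_right _ _).1 huv)

/-- The joining edge ends at the global minimum and the global maximum, neither of which can be the
middle of an increasing path. -/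
theorem isPathAlternating (hG : IsGlue h T₁ T₂ G) (h₁ : T₁.IsPathAlternating)
    (h₂ : T₂.IsPathAlternating) : G.IsPathAlternating := by
  rw [isPathAlternating_iff] at *
  intro u v w huv hvw h3 h4
  rcases cases_emb h u with ⟨x, rfl⟩ | ⟨x, rfl⟩ <;>
    rcases cases_emb h v with ⟨y, rfl⟩ | ⟨y, rfl⟩ <;>
    rcases cases_emb h w with ⟨z, rfl⟩ | ⟨z, rfl⟩
  · rw [hG.left_left] at huv hvw
    exact h₁ _ _ _ huv hvw ((leftEmb h).lt_iff_lt.1 h3) ((leftEmb h).lt_iff_lt.1 h4)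
  · rw [hG.left_right] at hvw
    rw [hvw.1] at h3
    exact absurd h3 (by simp)
  · exact (h4.trans (leftEmb_lt_rightEmb h z y)).false
  · rw [hG.left_right] at huv
    rw [huv.2] at h4
    exact absurd h4 (by simp [Fin.le_last])
  · exact (h3.trans (leftEmb_lt_rightEmb h y x)).false
  · exact (h3.trans (leftEmb_lt_rightEmb h y x)).false
  · exact (h4.trans (leftEmb_lt_rightEmb h z y)).false
  · rw [hG.right_right] at huv hvw
    exact h₂ _ _ _ huv hvw ((rightEmb h).lt_iff_lt.1 h3) ((rightEmb h).lt_iff_lt.1 h4)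

theorem cases_of_adj_of_lt (hG : IsGlue h T₁ T₂ G) {u v : Fin n} (huv : G.Adj u v) (hlt : u < v) :
    (∃ x y, x < y ∧ T₁.Adj x y ∧ leftEmb h x = u ∧ leftEmb h y = v) ∨
    (∃ x y, x < y ∧ T₂.Adj x y ∧ rightEmb h x = u ∧ rightEmb h y = v) ∨
    (leftEmb h 0 = u ∧ rightEmb h (Fin.last b) = v) := by
  rcases cases_emb h u with ⟨x, rfl⟩ | ⟨x, rfl⟩ <;> rcases cases_emb h v with ⟨y, rfl⟩ | ⟨y, rfl⟩
  · exact Or.inl ⟨x, y, (leftEmb h).lt_iff_lt.1 hlt, (hG.left_left _ _).1 huv, rfl, rfl⟩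
  · obtain ⟨rfl, rfl⟩ := (hG.left_right _ _).1 huv
    exact Or.inr (Or.inr ⟨rfl, rfl⟩)
  · exact absurd hlt (leftEmb_lt_rightEmb h y x).not_gt
  · exact Or.inr (Or.inl ⟨x, y, (rightEmb h).lt_iff_lt.1 hlt, (hG.right_right _ _).1 huv, rfl, rfl⟩)

theorem leftEmb_zero_le (h : a + b + 2 = n) (u : Fin n) : leftEmb h 0 ≤ u := by
  simp [Fin.le_def, val_leftEmb]

theorem le_rightEmb_last (h : a + b + 2 = n) (u : Fin n) : u ≤ rightEmb h (Fin.last b) := by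
  simp [Fin.le_def, val_rightEmb]; omega

/-- Edges of different blocks span disjoint intervals, and the joining edge spans everything, so a
crossing would lie inside one block. -/
theorem isNonCrossing (hG : IsGlue h T₁ T₂ G) (h₁ : T₁.IsNonCrossing)
    (h₂ : T₂.IsNonCrossing) : G.IsNonCrossing := by
  rintro i j k l hij hjk hkl ⟨hik, hjl⟩
  rcases hG.cases_of_adj_of_lt hjl (hjk.trans hkl) with
    ⟨j, l, -, hjl', rfl, rfl⟩ | ⟨j, l, -, hjl', rfl, rfl⟩ | ⟨rfl, rfl⟩
  · rcases hG.cases_of_adj_of_lt hik (hij.trans hjk) with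
      ⟨i, k, -, hik', rfl, rfl⟩ | ⟨i, k, -, hik', rfl, rfl⟩ | ⟨rfl, rfl⟩
    · simp only [OrderEmbedding.lt_iff_lt] at hij hjk hkl
      exact h₁ i j k l hij hjk hkl ⟨hik', hjl'⟩
    · exact (hkl.trans (leftEmb_lt_rightEmb h l k)).false
    · exact (hkl.trans (leftEmb_lt_rightEmb h l _)).false
  · rcases hG.cases_of_adj_of_lt hik (hij.trans hjk) with
      ⟨i, k, -, hik', rfl, rfl⟩ | ⟨i, k, -, hik', rfl, rfl⟩ | ⟨rfl, rfl⟩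
    · exact (hjk.trans (leftEmb_lt_rightEmb h k j)).false
    · simp only [OrderEmbedding.lt_iff_lt] at hij hjk hkl
      exact h₂ i j k l hij hjk hkl ⟨hik', hjl'⟩
    · exact absurd hkl (le_rightEmb_last h _).not_gt
  · exact absurd hij (leftEmb_zero_le h _).not_gt

theorem mem_altNonCrossingTrees_iff (hG : IsGlue h T₁ T₂ G) : G ∈ altNonCrossingTrees n ↔
    T₁ ∈ altNonCrossingTrees (a + 1) ∧ T₂ ∈ altNonCrossingTrees (b + 1) := by
  refine ⟨fun hm => ⟨hG.isRetract_left.mem_altNonCrossingTrees (by omega) hm,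
    hG.isRetract_right.mem_altNonCrossingTrees (by omega) hm⟩, ?_⟩
  simp only [SimpleGraph.mem_altNonCrossingTrees]
  exact fun ⟨h₁, h₂⟩ => ⟨hG.isTree h₁.1 h₂.1, hG.isPathAlternating h₁.2.1 h₂.2.1,
    hG.isNonCrossing h₁.2.2 h₂.2.2⟩

end IsGlue
end Glue

/-! ### Counting right and left pairs -/

/-- Ordered edges: pairs `(b, c)` with `b < c` adjacent. -/
def ltEdges {n : ℕ} (T : SimpleGraph (Fin n)) : Set (Fin n × Fin n) :=
  {p | p.1 < p.2 ∧ T.Adj p.1 p.2}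

/-- Right pairs as quadruples `(a, b, c, d)`. -/
def rightQuads {n : ℕ} (T : SimpleGraph (Fin n)) : Set (Fin n × Fin n × Fin n × Fin n) :=
  {p | p.1 ≤ p.2.1 ∧ p.2.1 < p.2.2.1 ∧ p.2.2.1 < p.2.2.2 ∧ T.Adj p.1 p.2.2.2 ∧
    T.InComponent p.1 p.2.2.2 p.1 p.2.1 p.2.2.1}

/-- Left pairs as quadruples `(a, b, c, d)`. -/
def leftQuads {n : ℕ} (T : SimpleGraph (Fin n)) : Set (Fin n × Fin n × Fin n × Fin n) :=
  {p | p.1 < p.2.1 ∧ p.2.1 < p.2.2.1 ∧ p.2.2.1 ≤ p.2.2.2 ∧ T.Adj p.1 p.2.2.2 ∧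
    T.InComponent p.1 p.2.2.2 p.2.2.2 p.2.1 p.2.2.1}

theorem sym2_eq_of_lt {n : ℕ} {a b c d : Fin n} (hab : a < b) (hcd : c < d)
    (h : s(a, b) = s(c, d)) : a = c ∧ b = d := by
  rcases Sym2.eq_iff.1 h with h | ⟨rfl, rfl⟩
  · exact h
  · exact absurd hab hcd.not_gt

theorem ncard_ltEdges {m : ℕ} {T : SimpleGraph (Fin (m + 1))} (hT : T.IsTree) :
    T.ltEdges.ncard = m := by
  have h1 : (fun p : Fin (m + 1) × Fin (m + 1) => s(p.1, p.2)) '' T.ltEdges = T.edgeSet := by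
    ext e
    induction e with | _ u v
    simp only [Set.mem_image, ltEdges, Set.mem_ofPred_eq, Prod.exists, mem_edgeSet]
    constructor
    · rintro ⟨x, y, ⟨-, hxy⟩, he⟩
      rw [← mem_edgeSet, ← he]
      exact hxy
    · intro huv
      rcases lt_or_gt_of_ne huv.ne with hlt | hlt
      · exact ⟨u, v, ⟨hlt, huv⟩, rfl⟩
      · exact ⟨v, u, ⟨hlt, huv.symm⟩, Sym2.eq_swap⟩
  have h2 := (isTree_iff_connected_and_card.1 hT).2
  rw [Nat.card_coe_set_eq, ← h1, Set.InjOn.ncard_image] at h2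
  · simpa using h2
  · rintro ⟨u, v⟩ ⟨h3, -⟩ ⟨x, y⟩ ⟨h4, -⟩ h5
    obtain ⟨rfl, rfl⟩ := sym2_eq_of_lt h3 h4 h5
    rfl

/-- An unordered pair determines its quadruple: if the two edges exchanged roles, then `c < d = c' <
d' = c`. -/
theorem rp_eq {n : ℕ} (T : SimpleGraph (Fin n)) : T.rp = T.rightQuads.ncard := by
  have h1 : (fun p : Fin n × Fin n × Fin n × Fin n => s(s(p.1, p.2.2.2), s(p.2.1, p.2.2.1))) ''
      T.rightQuads = T.rightPairs := by
    ext P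
    constructor
    · rintro ⟨⟨a, b, c, d⟩, ⟨h1, h2, h3, h4, h5⟩, rfl⟩
      refine ⟨s(a, d), h4, s(b, c), h5.1.1, fun he => ?_, rfl, a, b, c, d, rfl, rfl, h1, h2, h3, h5⟩
      exact h3.ne' (sym2_eq_of_lt ((h1.trans_lt h2).trans h3) h2 he).2
    · rintro ⟨_, h4, _, -, -, rfl, a, b, c, d, rfl, rfl, h1, h2, h3, h5⟩
      exact ⟨(a, b, c, d), ⟨h1, h2, h3, h4, h5⟩, rfl⟩
  rw [rp, ← h1, Set.InjOn.ncard_image]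
  rintro ⟨a, b, c, d⟩ ⟨h1, h2, h3, -⟩ ⟨a', b', c', d'⟩ ⟨h1', h2', h3', -⟩ he
  have had := (h1.trans_lt h2).trans h3
  have had' := (h1'.trans_lt h2').trans h3'
  rcases Sym2.eq_iff.1 he with ⟨e1, e2⟩ | ⟨e1, e2⟩
  · obtain ⟨rfl, rfl⟩ := sym2_eq_of_lt had had' e1
    obtain ⟨rfl, rfl⟩ := sym2_eq_of_lt h2 h2' e2
    rfl
  · obtain ⟨rfl, rfl⟩ := sym2_eq_of_lt had h2' e1
    obtain ⟨rfl, rfl⟩ := sym2_eq_of_lt h2 had' e2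
    exact (h3.trans h3').false.elim

theorem lp_eq {n : ℕ} (T : SimpleGraph (Fin n)) : T.lp = T.leftQuads.ncard := by
  have h1 : (fun p : Fin n × Fin n × Fin n × Fin n => s(s(p.2.1, p.2.2.1), s(p.1, p.2.2.2))) ''
      T.leftQuads = T.leftPairs := by
    ext P
    constructor
    · rintro ⟨⟨a, b, c, d⟩, ⟨h1, h2, h3, h4, h5⟩, rfl⟩
      refine ⟨s(b, c), h5.1.1, s(a, d), h4, fun he => ?_, rfl, a, b, c, d, rfl, rfl, h1, h2, h3, h5⟩
      exact h1.ne' (sym2_eq_of_lt h2 (h1.trans (h2.trans_le h3)) he).1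
    · rintro ⟨_, -, _, h4, -, rfl, a, b, c, d, rfl, rfl, h1, h2, h3, h5⟩
      exact ⟨(a, b, c, d), ⟨h1, h2, h3, h4, h5⟩, rfl⟩
  rw [lp, ← h1, Set.InjOn.ncard_image]
  rintro ⟨a, b, c, d⟩ ⟨h1, h2, h3, -⟩ ⟨a', b', c', d'⟩ ⟨h1', h2', h3', -⟩ he
  have had := h1.trans (h2.trans_le h3)
  have had' := h1'.trans (h2'.trans_le h3')
  rcases Sym2.eq_iff.1 he with ⟨e1, e2⟩ | ⟨e1, e2⟩
  · obtain ⟨rfl, rfl⟩ := sym2_eq_of_lt had had' e2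
    obtain ⟨rfl, rfl⟩ := sym2_eq_of_lt h2 h2' e1
    rfl
  · obtain ⟨rfl, rfl⟩ := sym2_eq_of_lt h2 had' e1
    obtain ⟨rfl, rfl⟩ := sym2_eq_of_lt had h2' e2
    exact (h1.trans h1').false.elim

/-- Apply a map to all four entries of a quadruple. -/
def mapQuad {α β : Type*} (f : α → β) (p : α × α × α × α) : β × β × β × β :=
  (f p.1, f p.2.1, f p.2.2.1, f p.2.2.2)

theorem mapQuad_injective {α β : Type*} {f : α → β} (hf : Function.Injective f) :
    Function.Injective (mapQuad f) := by
  rintro ⟨a, b, c, d⟩ ⟨a', b', c', d'⟩ h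
  simpa [mapQuad, hf.eq_iff] using h

theorem IsRetract.mapQuad_mem_rightQuads_iff {s n : ℕ} {φ : Fin s ↪o Fin n} {ρ : Fin n → Fin s}
    {T : SimpleGraph (Fin s)} {G : SimpleGraph (Fin n)} (h : IsRetract φ ρ T G)
    (p : Fin s × Fin s × Fin s × Fin s) : mapQuad φ p ∈ G.rightQuads ↔ p ∈ T.rightQuads := by
  simp [rightQuads, mapQuad, h.adj_iff, h.inComponent_iff]

theorem IsRetract.mapQuad_mem_leftQuads_iff {s n : ℕ} {φ : Fin s ↪o Fin n} {ρ : Fin n → Fin s}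
    {T : SimpleGraph (Fin s)} {G : SimpleGraph (Fin n)} (h : IsRetract φ ρ T G)
    (p : Fin s × Fin s × Fin s × Fin s) : mapQuad φ p ∈ G.leftQuads ↔ p ∈ T.leftQuads := by
  simp [leftQuads, mapQuad, h.adj_iff, h.inComponent_iff]

namespace IsGlue

variable {a b n : ℕ} {h : a + b + 2 = n} {T₁ : SimpleGraph (Fin (a + 1))}
  {T₂ : SimpleGraph (Fin (b + 1))} {G : SimpleGraph (Fin n)}

theorem inComponent_zero_iff (hG : IsGlue h T₁ T₂ G) (hT : T₁.Connected) (u v : Fin n) :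
    G.InComponent (leftEmb h 0) (rightEmb h (Fin.last b)) (leftEmb h 0) u v ↔
      ∃ x y, T₁.Adj x y ∧ leftEmb h x = u ∧ leftEmb h y = v := by
  rw [InComponent, hG.reachable_deleteEdges_zero_iff hT, hG.reachable_deleteEdges_zero_iff hT]
  constructor
  · rintro ⟨huv, hu, hv⟩
    obtain ⟨x, rfl⟩ := exists_leftEmb h hu
    obtain ⟨y, rfl⟩ := exists_leftEmb h hv
    exact ⟨x, y, (hG.left_left _ _).1 huv.1, rfl, rfl⟩
  · rintro ⟨x, y, hxy, rfl, rfl⟩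
    refine ⟨?_, Nat.lt_succ_iff.1 x.2, Nat.lt_succ_iff.1 y.2⟩
    rw [deleteEdges_adj, hG.left_left]
    simp [hxy, (leftEmb_lt_rightEmb h _ _).ne]

theorem inComponent_last_iff (hG : IsGlue h T₁ T₂ G) (hT : T₂.Connected) (u v : Fin n) :
    G.InComponent (leftEmb h 0) (rightEmb h (Fin.last b)) (rightEmb h (Fin.last b)) u v ↔
      ∃ x y, T₂.Adj x y ∧ rightEmb h x = u ∧ rightEmb h y = v := by
  rw [InComponent, hG.reachable_deleteEdges_last_iff hT, hG.reachable_deleteEdges_last_iff hT]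
  constructor
  · rintro ⟨huv, hu, hv⟩
    obtain ⟨x, rfl⟩ := exists_rightEmb h hu
    obtain ⟨y, rfl⟩ := exists_rightEmb h hv
    exact ⟨x, y, (hG.right_right _ _).1 huv.1, rfl, rfl⟩
  · rintro ⟨x, y, hxy, rfl, rfl⟩
    refine ⟨?_, by rw [val_rightEmb]; omega, by rw [val_rightEmb]; omega⟩
    rw [deleteEdges_adj, hG.right_right]
    simp [hxy, (leftEmb_lt_rightEmb h _ _).ne']

theorem exists_leftEmb_of_le {h : a + b + 2 = n} {u : Fin n} {x : Fin (a + 1)}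
    (hu : u ≤ leftEmb h x) : ∃ y, leftEmb h y = u :=
  exists_leftEmb h (by rw [Fin.le_def, val_leftEmb] at hu; omega)

theorem exists_rightEmb_of_le {h : a + b + 2 = n} {u : Fin n} {x : Fin (b + 1)}
    (hu : rightEmb h x ≤ u) : ∃ y, rightEmb h y = u :=
  exists_rightEmb h (by rw [Fin.le_def, val_rightEmb] at hu; omega)

/-- Sort by the edge `{a, d}`. If it lies in a block, `b` and `c` lie between its ends and hence in
the same block. If it is the joining edge, the component of its left end is the left block. -/
theorem rightQuads_eq (hG : IsGlue h T₁ T₂ G) (hT : T₁.Connected) :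
    G.rightQuads = (mapQuad (leftEmb h) '' T₁.rightQuads ∪ mapQuad (rightEmb h) '' T₂.rightQuads) ∪
      (fun p : Fin (a + 1) × Fin (a + 1) =>
        (leftEmb h 0, leftEmb h p.1, leftEmb h p.2, rightEmb h (Fin.last b))) '' T₁.ltEdges := by
  ext p
  constructor
  · intro hp
    obtain ⟨u, v, w, z⟩ := p
    have ⟨h1, h2, h3, h4, h5⟩ := hp
    dsimp only at h1 h2 h3 h4 h5
    rcases hG.cases_of_adj_of_lt h4 ((h1.trans_lt h2).trans h3) with
      ⟨u, z, -, -, rfl, rfl⟩ | ⟨u, z, -, -, rfl, rfl⟩ | ⟨rfl, rfl⟩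
    · obtain ⟨w, rfl⟩ := exists_leftEmb_of_le h3.le
      obtain ⟨v, rfl⟩ := exists_leftEmb_of_le h2.le
      exact Or.inl (Or.inl ⟨(u, v, w, z),
        (hG.isRetract_left.mapQuad_mem_rightQuads_iff (u, v, w, z)).1 hp, rfl⟩)
    · obtain ⟨v, rfl⟩ := exists_rightEmb_of_le h1
      obtain ⟨w, rfl⟩ := exists_rightEmb_of_le h2.le
      exact Or.inl (Or.inr ⟨(u, v, w, z),
        (hG.isRetract_right.mapQuad_mem_rightQuads_iff (u, v, w, z)).1 hp, rfl⟩)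
    · obtain ⟨x, y, hxy, rfl, rfl⟩ := (hG.inComponent_zero_iff hT v w).1 h5
      exact Or.inr ⟨(x, y), ⟨(leftEmb h).lt_iff_lt.1 h2, hxy⟩, rfl⟩
  · rintro ((⟨p, hp, rfl⟩ | ⟨p, hp, rfl⟩) | ⟨⟨x, y⟩, ⟨hxy, hadj⟩, rfl⟩)
    · exact (hG.isRetract_left.mapQuad_mem_rightQuads_iff p).2 hp
    · exact (hG.isRetract_right.mapQuad_mem_rightQuads_iff p).2 hp
    · exact ⟨leftEmb_zero_le h _, (leftEmb h).lt_iff_lt.2 hxy, leftEmb_lt_rightEmb h _ _,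
        hG.adj_top, (hG.inComponent_zero_iff hT _ _).2 ⟨x, y, hadj, rfl, rfl⟩⟩

theorem leftQuads_eq (hG : IsGlue h T₁ T₂ G) (hT : T₂.Connected) :
    G.leftQuads = (mapQuad (leftEmb h) '' T₁.leftQuads ∪ mapQuad (rightEmb h) '' T₂.leftQuads) ∪
      (fun p : Fin (b + 1) × Fin (b + 1) =>
        (leftEmb h 0, rightEmb h p.1, rightEmb h p.2, rightEmb h (Fin.last b))) '' T₂.ltEdges := by
  ext p
  constructor
  · intro hp
    obtain ⟨u, v, w, z⟩ := p
    have ⟨h1, h2, h3, h4, h5⟩ := hp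
    dsimp only at h1 h2 h3 h4 h5
    rcases hG.cases_of_adj_of_lt h4 (h1.trans (h2.trans_le h3)) with
      ⟨u, z, -, -, rfl, rfl⟩ | ⟨u, z, -, -, rfl, rfl⟩ | ⟨rfl, rfl⟩
    · obtain ⟨w, rfl⟩ := exists_leftEmb_of_le h3
      obtain ⟨v, rfl⟩ := exists_leftEmb_of_le h2.le
      exact Or.inl (Or.inl ⟨(u, v, w, z),
        (hG.isRetract_left.mapQuad_mem_leftQuads_iff (u, v, w, z)).1 hp, rfl⟩)
    · obtain ⟨v, rfl⟩ := exists_rightEmb_of_le h1.le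
      obtain ⟨w, rfl⟩ := exists_rightEmb_of_le h2.le
      exact Or.inl (Or.inr ⟨(u, v, w, z),
        (hG.isRetract_right.mapQuad_mem_leftQuads_iff (u, v, w, z)).1 hp, rfl⟩)
    · obtain ⟨x, y, hxy, rfl, rfl⟩ := (hG.inComponent_last_iff hT v w).1 h5
      exact Or.inr ⟨(x, y), ⟨(rightEmb h).lt_iff_lt.1 h2, hxy⟩, rfl⟩
  · rintro ((⟨p, hp, rfl⟩ | ⟨p, hp, rfl⟩) | ⟨⟨x, y⟩, ⟨hxy, hadj⟩, rfl⟩)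
    · exact (hG.isRetract_left.mapQuad_mem_leftQuads_iff p).2 hp
    · exact (hG.isRetract_right.mapQuad_mem_leftQuads_iff p).2 hp
    · exact ⟨leftEmb_lt_rightEmb h _ _, (rightEmb h).lt_iff_lt.2 hxy, le_rightEmb_last h _,
        hG.adj_top, (hG.inComponent_last_iff hT _ _).2 ⟨x, y, hadj, rfl, rfl⟩⟩

/-- The three parts of the decomposition of the pairs of a glued tree are distinguished by the
first and last entries of the quadruple. -/
theorem ncard_quads (h : a + b + 2 = n)
    (A : Set (Fin (a + 1) × Fin (a + 1) × Fin (a + 1) × Fin (a + 1)))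
    (B : Set (Fin (b + 1) × Fin (b + 1) × Fin (b + 1) × Fin (b + 1)))
    {s : ℕ} (φ : Fin s ↪o Fin n) (C : Set (Fin s × Fin s)) :
    ((mapQuad (leftEmb h) '' A ∪ mapQuad (rightEmb h) '' B) ∪ (fun p : Fin s × Fin s =>
      (leftEmb h 0, φ p.1, φ p.2, rightEmb h (Fin.last b))) '' C).ncard =
        A.ncard + B.ncard + C.ncard := by
  have hne := fun x y => (leftEmb_lt_rightEmb h x y).ne
  rw [Set.ncard_union_eq, Set.ncard_union_eq,
    Set.ncard_image_of_injective _ (mapQuad_injective (leftEmb h).injective),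
    Set.ncard_image_of_injective _ (mapQuad_injective (rightEmb h).injective),
    Set.ncard_image_of_injective]
  · rintro ⟨x, y⟩ ⟨x', y'⟩ he
    simpa using he
  · rw [Set.disjoint_left]
    rintro _ ⟨p, -, rfl⟩ ⟨p', -, he⟩
    exact hne _ _ (congrArg Prod.fst he).symm
  · rw [Set.disjoint_left]
    rintro _ (⟨p, -, rfl⟩ | ⟨p, -, rfl⟩) ⟨p', -, he⟩
    · exact hne _ _ (congrArg (fun q => q.2.2.2) he).symm
    · exact hne _ _ (congrArg Prod.fst he)

theorem rp_eq (hG : IsGlue h T₁ T₂ G) (hT : T₁.IsTree) : G.rp = T₁.rp + T₂.rp + a := by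
  rw [SimpleGraph.rp_eq, SimpleGraph.rp_eq, SimpleGraph.rp_eq, hG.rightQuads_eq hT.connected,
    ncard_quads, ncard_ltEdges hT]

theorem lp_eq (hG : IsGlue h T₁ T₂ G) (hT : T₂.IsTree) : G.lp = T₁.lp + T₂.lp + b := by
  rw [SimpleGraph.lp_eq, SimpleGraph.lp_eq, SimpleGraph.lp_eq, hG.leftQuads_eq hT.connected,
    ncard_quads, ncard_ltEdges hT]

end IsGlue

/-! ### Every tree is a glued tree, in one way -/

/-- Let `d` be the largest neighbour of `0`. If `d` is not last, some edge `{u, v}` has `u ≤ d < v`.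
Then `u = 0` contradicts maximality, `u = d` contradicts alternation, and otherwise `{u, v}` crosses
`{0, d}`. -/
theorem adj_zero_last {m : ℕ} {T : SimpleGraph (Fin (m + 2))}
    (hT : T ∈ altNonCrossingTrees (m + 2)) : T.Adj 0 (Fin.last (m + 1)) := by
  rw [mem_altNonCrossingTrees, isPathAlternating_iff] at hT
  obtain ⟨htree, halt, hnc⟩ := hT
  have hc := htree.connected
  obtain ⟨x, y, hxy, rfl, -⟩ := (hc 0 (Fin.last (m + 1))).exists_adj_of_mem_of_notMem {0} rfl
    (Fin.last_pos).ne'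
  obtain ⟨d, hd, hmax⟩ := Set.exists_max_image {v | T.Adj 0 v} id (Set.toFinite _) ⟨y, hxy⟩
  have hd : T.Adj 0 d := hd
  have hd0 : 0 < d := Fin.pos_iff_ne_zero.2 hd.ne'
  by_contra hlast
  have hdl : d < Fin.last (m + 1) := (Fin.le_last d).lt_of_ne fun he => hlast (he ▸ hd)
  obtain ⟨u, v, huv, hu, hv, -⟩ := (hc 0 (Fin.last (m + 1))).exists_adj_of_mem_of_notMem
    (Set.Iic d) (Fin.zero_le d) (not_le.2 hdl)
  have hu : u ≤ d := hu
  have hv : d < v := not_le.1 hv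
  rcases (Fin.zero_le u).eq_or_lt with rfl | hu0
  · exact (hmax v huv).not_gt hv
  · rcases hu.eq_or_lt with rfl | hud
    · exact halt _ _ _ hd huv hd0 hv
    · exact hnc 0 u d v hu0 hud hv ⟨hd, huv⟩

theorem exists_isGlue {m : ℕ} {T : SimpleGraph (Fin (m + 2))}
    (hT : T ∈ altNonCrossingTrees (m + 2)) :
    ∃ (k : Fin (m + 1)) (h : (k : ℕ) + (m - k) + 2 = m + 2) (T₁ : SimpleGraph (Fin (k + 1)))
      (T₂ : SimpleGraph (Fin (m - k + 1))), IsGlue h T₁ T₂ T := by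
  have hadj := adj_zero_last hT
  rw [mem_altNonCrossingTrees] at hT
  obtain ⟨htree, -, hnc⟩ := hT
  set H := T.deleteEdges {s(0, Fin.last (m + 1))} with hH
  have hHT : ∀ {u v}, H.Adj u v → T.Adj u v := fun h => h.1
  have hbridge : ¬ H.Reachable 0 (Fin.last (m + 1)) :=
    isAcyclic_iff_forall_adj_isBridge.1 htree.isAcyclic hadj
  -- An edge leaving the union of the two components would have to be the deleted one, whose ends
  -- both lie in the union.
  have hcases : ∀ u, H.Reachable 0 u ∨ H.Reachable (Fin.last (m + 1)) u := by
    intro u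
    by_contra! hu
    obtain ⟨x, y, hxy, hx, hy, -⟩ := (htree.connected 0 u).exists_adj_of_mem_of_notMem
      {w | H.Reachable 0 w ∨ H.Reachable (Fin.last (m + 1)) w} (Or.inl (Reachable.refl _))
      (by simpa using hu)
    simp only [Set.mem_ofPred_eq, not_or] at hx hy
    have hxyH : ¬ H.Adj x y := fun he => hx.elim (fun h' => hy.1 (h'.trans he.reachable))
      fun h' => hy.2 (h'.trans he.reachable)
    have he : s(x, y) = s(0, Fin.last (m + 1)) := by
      by_contra he
      exact hxyH (by rw [hH, deleteEdges_adj]; exact ⟨hxy, he⟩)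
    rcases Sym2.eq_iff.1 he with ⟨-, rfl⟩ | ⟨-, rfl⟩
    · exact hy.2 (Reachable.refl _)
    · exact hy.1 (Reachable.refl _)
  obtain ⟨k, hk, hmax⟩ := Set.exists_max_image {v | H.Reachable 0 v} id (Set.toFinite _)
    ⟨0, Reachable.refl _⟩
  have hk : H.Reachable 0 k := hk
  have hkl : k < Fin.last (m + 1) := (Fin.le_last k).lt_of_ne fun he => hbridge (he ▸ hk)
  -- If some `x ≤ k` were in the component of the last vertex, that component would have an edge `y
  -- < k < z`, and the component of `0` an edge `u < y < v`. Since `v ≤ k < z`, these cross.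
  have hle : ∀ x, H.Reachable 0 x ↔ x ≤ k := by
    refine fun x => ⟨hmax x, fun hx => ?_⟩
    by_contra hx0
    have hxl := (hcases x).resolve_left hx0
    have hdisj : ∀ y, H.Reachable (Fin.last (m + 1)) y → ¬ H.Reachable 0 y :=
      fun y h1 h2 => hbridge (h2.trans h1.symm)
    obtain ⟨z, y, hzy, hz, hy, hzl, hyl⟩ := hxl.exists_adj_of_mem_of_notMem
      (Set.Ioi k) hkl (not_lt.2 hx)
    have hz : k < z := hz
    have hyk : y < k := (not_lt.1 hy).lt_of_ne fun he => hdisj y hyl (he ▸ hk)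
    have hy0 : 0 < y := Fin.pos_iff_ne_zero.2 fun he => hdisj y hyl (he ▸ Reachable.refl _)
    obtain ⟨u, v, huv, hu, hv, hur, hvr⟩ := hk.exists_adj_of_mem_of_notMem
      (Set.Iio y) hy0 (not_lt.2 hyk.le)
    have hyv : y < v := (not_lt.1 hv).lt_of_ne fun he => hdisj y hyl (he ▸ hvr)
    exact hnc u y v z hu hyv ((hmax v hvr).trans_lt hz) ⟨hHT huv, (hHT hzy).symm⟩
  have hkm : (k : ℕ) < m + 1 := hkl
  have h : (k : ℕ) + (m - k) + 2 = m + 2 := by omega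
  refine ⟨⟨k, hkm⟩, h, T.comap (leftEmb h), T.comap (rightEmb h), fun _ _ => Iff.rfl,
    fun _ _ => Iff.rfl, fun x y => ?_⟩
  have h0 : leftEmb h 0 = 0 := rfl
  have hl : rightEmb h (Fin.last _) = Fin.last (m + 1) := Fin.ext (by
    rw [val_rightEmb]; simp only [Fin.val_last]; omega)
  constructor
  · intro hxy
    by_cases he : s(leftEmb h x, rightEmb h y) = s(0, Fin.last (m + 1))
    · rw [← h0, ← hl] at he
      simpa [(leftEmb_lt_rightEmb h _ _).ne] using he
    · have hxyH : H.Adj (leftEmb h x) (rightEmb h y) := by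
        rw [hH, deleteEdges_adj]
        exact ⟨hxy, he⟩
      have hx : leftEmb h x ≤ k := Nat.lt_succ_iff.1 x.2
      have := (hle _).1 (((hle _).2 hx).trans hxyH.reachable)
      rw [Fin.le_def, val_rightEmb] at this
      omega
  · rintro ⟨rfl, rfl⟩
    rw [h0, hl]
    exact hadj

/-- Both decompositions delete the same edge. Vertex `a` then stays connected to `0`, so it lies in
the other left block. Used in both directions, this fixes the cut point. -/
theorem IsGlue.index_le {a b a' b' n : ℕ} {h : a + b + 2 = n} {h' : a' + b' + 2 = n}
    {T₁ : SimpleGraph (Fin (a + 1))} {T₂ : SimpleGraph (Fin (b + 1))}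
    {T₁' : SimpleGraph (Fin (a' + 1))} {T₂' : SimpleGraph (Fin (b' + 1))}
    {G : SimpleGraph (Fin n)} (hG : IsGlue h T₁ T₂ G) (hG' : IsGlue h' T₁' T₂' G)
    (hT : T₁.Connected) : a ≤ a' := by
  have h1 := hG.reachable_deleteEdges_left hT 0 (Fin.last a)
  have h0 : leftEmb h 0 = leftEmb h' 0 := rfl
  have hl : rightEmb h (Fin.last b) = rightEmb h' (Fin.last b') := Fin.ext (by
    rw [val_rightEmb, val_rightEmb]; simp only [Fin.val_last]; omega)
  rw [h0, hl] at h1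
  exact hG'.le_of_reachable_deleteEdges h1 (by simp [val_leftEmb])

/-! ### The base case and the recursion -/

theorem altNonCrossingTrees_one : altNonCrossingTrees 1 = {⊥} := by
  ext T
  have hT : T = ⊥ := Subsingleton.elim _ _
  subst hT
  rw [mem_altNonCrossingTrees, isPathAlternating_iff]
  simp only [Finset.mem_singleton, iff_true]
  exact ⟨IsTree.of_subsingleton, by simp, fun i j _ _ hij => by omega⟩

theorem rp_bot {n : ℕ} : (⊥ : SimpleGraph (Fin n)).rp = 0 := by
  simp [rp, rightPairs]

theorem lp_bot {n : ℕ} : (⊥ : SimpleGraph (Fin n)).lp = 0 := by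
  simp [lp, leftPairs]

theorem sum_altNonCrossingTrees_succ {R : Type*} [CommSemiring R] (q t : R) (m : ℕ) :
    ∑ T ∈ altNonCrossingTrees (m + 2), q ^ T.rp * t ^ T.lp =
      ∑ k : Fin (m + 1), q ^ (k : ℕ) * t ^ (m - (k : ℕ)) *
        (∑ T ∈ altNonCrossingTrees (k + 1), q ^ T.rp * t ^ T.lp) *
        ∑ T ∈ altNonCrossingTrees (m - k + 1), q ^ T.rp * t ^ T.lp := by
  have h (k : Fin (m + 1)) : (k : ℕ) + (m - k) + 2 = m + 2 := by omega
  simp_rw [mul_assoc _ (∑ T ∈ _, _), Finset.sum_mul_sum, ← Finset.sum_product',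
    Finset.mul_sum, Finset.sum_sigma']
  symm
  refine Finset.sum_bij (fun p _ => glue (h p.1) p.2.1 p.2.2) ?_ ?_ ?_ ?_
  · rintro ⟨k, T₁, T₂⟩ hp
    simp only [Finset.mem_sigma, Finset.mem_univ, true_and, Finset.mem_product] at hp
    exact (isGlue_glue _ _ _).mem_altNonCrossingTrees_iff.2 hp
  · rintro ⟨k, T₁, T₂⟩ hp ⟨k', T₁', T₂'⟩ hp' he
    simp only [Finset.mem_sigma, Finset.mem_univ, true_and, Finset.mem_product,
      mem_altNonCrossingTrees] at hp hp' he
    have hg := isGlue_glue (h k) T₁ T₂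
    have hg' := isGlue_glue (h k') T₁' T₂'
    rw [← he] at hg'
    -- The cut points must be identified first: the types of the blocks depend on them.
    obtain rfl : k = k' := Fin.ext ((hg.index_le hg' hp.1.1.connected).antisymm
      (hg'.index_le hg hp'.1.1.connected))
    obtain rfl : T₁ = T₁' := by
      ext x y
      rw [← hg.left_left, hg'.left_left]
    obtain rfl : T₂ = T₂' := by
      ext x y
      rw [← hg.right_right, hg'.right_right]
    rfl
  · intro T hT
    obtain ⟨k, hk, T₁, T₂, hG⟩ := exists_isGlue hT
    exact ⟨⟨k, T₁, T₂⟩, by simpa using hG.mem_altNonCrossingTrees_iff.1 hT, hG.eq_glue.symm⟩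
  · rintro ⟨k, T₁, T₂⟩ hp
    simp only [Finset.mem_sigma, Finset.mem_univ, true_and, Finset.mem_product,
      mem_altNonCrossingTrees] at hp
    have hg := isGlue_glue (h k) T₁ T₂
    simp only
    rw [hg.rp_eq hp.1.1, hg.lp_eq hp.2.1]
    ring

end SimpleGraph

theorem mainTheorem7 {R : Type*} [CommSemiring R] (q t : R) (n : ℕ) (hn : 0 < n) :
    ∑ T ∈ SimpleGraph.altNonCrossingTrees n, q ^ T.rp * t ^ T.lp = qtCatalan q t (n - 1) := by
  induction n using Nat.strong_induction_on with
  | _ n ih =>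
    match n, hn with
    | 1, _ => simp [SimpleGraph.altNonCrossingTrees_one, SimpleGraph.rp_bot, SimpleGraph.lp_bot,
        qtCatalan]
    | m + 2, _ =>
      rw [SimpleGraph.sum_altNonCrossingTrees_succ, show m + 2 - 1 = m + 1 from rfl, qtCatalan]
      refine Finset.sum_congr rfl fun k _ => ?_
      rw [ih (k + 1) (by omega) (by omega), ih (m - k + 1) (by omega) (by omega)]
      rfl
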